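/- An alphabet is a nonempty finite set, and all families below range over languages over arbitrary alphabets. Let $\mathrm{CFL}$ be the family of context-free languages. For a family $\mathcal C$ of languages, let $\mathrm{co}\text{-}\mathcal C$ be the family of all languages $L$ (over an alphabet $\Sigma$) whose complement $\Sigma^*\setminus L$ is in $\mathcal C$, and let $\mathcal C/n$ be the family of all languages $L$ over an alphabet $\Sigma$ for which there are an alphabet $\Gamma$, a function $h:\mathbb N\to\Gamma^*$ with $|h(m)|=m$ for all $m\in\mathbb N$ (not necessarily computable), and a language $L'\in\mathcal C$ over $\Sigma\times\Gamma$ such that for every $x=x_1\cdots x_m\in\Sigma^*$, with $h(m)=\sigma_1\cdots\sigma_m$, $$x\in L\iff (x_1,\sigma_1)(x_2,\sigma_2)\cdots(x_m,\sigma_m)\in L'.$$ Let $\mathrm{Equal}_6$ be the language of all strings $w$ over the seven-letter alphabet $\{a_1,\dots,a_6,\#\}$ in which $a_1,\dots,a_6$ all occur the same number of times (with no condition on the number of occurrences of $\#$). Proposition 4.4. The language $\mathrm{Equal}_6$ is in $\mathrm{co}\text{-}\mathrm{CFL}$ but not in $\mathrm{CFL}/n$. Hence $\mathrm{co}\text{-}\mathrm{CFL}\not\subseteq\mathrm{CFL}/n$;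 moreover $\mathrm{co}\text{-}\mathrm{CFL}/n\neq\mathrm{CFL}/n$, whether $\mathrm{co}\text{-}\mathrm{CFL}/n$ is read as $(\mathrm{co}\text{-}\mathrm{CFL})/n$ or as $\mathrm{co}\text{-}(\mathrm{CFL}/n)$, and $\mathrm{CFL}/n$ is not closed under complementation. -/

import Mathlib

/-- A formal language together with its alphabet, a nonempty finite type of symbols. -/
structure FormalLanguage where
  /-- The alphabet `Σ`. -/
  Alphabet : Type
  [finite : Finite Alphabet]
  [nonempty : Nonempty Alphabet]
  /-- The set of strings over the alphabet. -/
  strings : Language Alphabet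

attribute [instance] FormalLanguage.finite FormalLanguage.nonempty

/-- A family of languages, over arbitrary (nonempty finite) alphabets. -/
abbrev LanguageFamily : Type 1 := Set FormalLanguage

/-- The complement `Σ* - L` of a language `L` over the alphabet `Σ`. -/
def FormalLanguage.complement (L : FormalLanguage) : FormalLanguage where
  Alphabet := L.Alphabet
  strings := {w : List L.Alphabet | w ∉ L.strings}

namespace LanguageFamily

/-- The family `CFL` of context-free languages. -/
def CFL : LanguageFamily := {L | L.strings.IsContextFree}

/-- The family `co-C` of all languages whose complements are in `C`. -/
def co (C : LanguageFamily) : LanguageFamily := {L | L.complement ∈ C}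

/-- The advised family `C/n`. A language `L` over `Σ` belongs to it if there are an advice alphabet
`Γ`, an advice function `h : ℕ → Γ*` with `|h n| = n` for all `n`, and a language `L'` in `C` over
the two-track alphabet `Σ × Γ` such that a string `x` over `Σ` is in `L` if and only if the
two-track string with upper track `x` and lower track `h |x|` is in `L'`. -/
def advised (C : LanguageFamily) : LanguageFamily :=
  {L | ∃ (Γ : Type) (_ : Finite Γ) (_ : Nonempty Γ) (h : ℕ → List Γ)
      (L' : Language (L.Alphabet × Γ)),
      (∀ n, (h n).length = n) ∧
      (FormalLanguage.mk (L.Alphabet × Γ) L') ∈ C ∧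
      ∀ x : List L.Alphabet, x ∈ L.strings ↔ x.zip (h x.length) ∈ L'}

/-- A family of languages is closed under complementation. -/
def ClosedUnderComplement (C : LanguageFamily) : Prop :=
  ∀ L ∈ C, L.complement ∈ C

end LanguageFamily

/-- The language `Equal₆` over the seven-letter alphabet `{a₁, …, a₆, #}`, where `some i` stands for
a letter `aᵢ` and `none` for the separator `#`: all strings in which each of the six symbols other
than `#` appears the same number of times. -/
def Equal6 : FormalLanguage where
  Alphabet := Option (Fin 6)
  strings := {w : List (Option (Fin 6)) | ∀ i j : Fin 6, w.count (some i) = w.count (some j)}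

/-! A context-free language has finitely many classes of interchangeable factors
(`Language.IsContextFree.exists_interchange`), and advice depends only on the length of the input.
Hence, in two words of equal length, factors of the same class and position can be swapped without
disturbing the advice track.

The test words, all in `Equal6`, carry five parameters below `P`. Letter `k < 5` occurs in region
`k` and, in complementary amount, in the opposite region `k + 5`. A factor of medium length meets
only one of the two for three of these letters, so its letter counts reveal three parameters
(`exists_region`, `card_filter_testLetter_ne`); its count of the sixth letter depends on position
alone. Class, position and the two other parameters take `O(P ^ 4)` values against `P ^ 5` words, so
two words collide, and the swap unbalances some letter against the sixth.

Conversely, a word outside `Equal6` has more of one letter than of another: its sum is positive for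
some weights in `{-1, 0, 1}`, which `posWeightGrammar` expresses. -/

namespace ContextFreeGrammar

/-! ### Big-step derivations in context-free grammars. -/

variable {T : Type*}

/-- Big-step derivability of a terminal word from a sentential form. -/
inductive Yields (g : ContextFreeGrammar T) : List (Symbol T g.NT) → List T → Prop
  | nil : Yields g [] []
  | terminal (a : T) {β : List (Symbol T g.NT)} {y : List T} (h : Yields g β y) :
      Yields g (.terminal a :: β) (a :: y)
  | nonterminal {r : ContextFreeRule T g.NT} (hr : r ∈ g.rules) {β : List (Symbol T g.NT)}
      {y z : List T} (h₁ : Yields g r.output y) (h₂ : Yields g β z) :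
      Yields g (.nonterminal r.input :: β) (y ++ z)

variable {g : ContextFreeGrammar T}

lemma Yields.append {β γ : List (Symbol T g.NT)} {y z : List T} (h₁ : g.Yields β y)
    (h₂ : g.Yields γ z) : g.Yields (β ++ γ) (y ++ z) := by
  induction h₁ with
  | nil => exact h₂
  | terminal a _ ih => exact ih.terminal a
  | nonterminal hr h _ _ ih =>
    rw [List.append_assoc]
    exact .nonterminal hr h ih

lemma yields_append_iff {β γ : List (Symbol T g.NT)} {w : List T} :
    g.Yields (β ++ γ) w ↔ ∃ y z, w = y ++ z ∧ g.Yields β y ∧ g.Yields γ z := by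
  refine ⟨fun h ↦ ?_, fun ⟨y, z, hw, hy, hz⟩ ↦ hw ▸ hy.append hz⟩
  induction β generalizing w with
  | nil => exact ⟨[], w, rfl, .nil, h⟩
  | cons s β ih =>
    rw [List.cons_append] at h
    cases h with
    | terminal a h =>
      obtain ⟨y, z, rfl, hy, hz⟩ := ih h
      exact ⟨a :: y, z, rfl, hy.terminal a, hz⟩
    | nonterminal hr h₁ h₂ =>
      obtain ⟨y, z, rfl, hy, hz⟩ := ih h₂
      exact ⟨_ ++ y, z, (List.append_assoc ..).symm, .nonterminal hr h₁ hy, hz⟩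

lemma yields_nonterminal_iff {A : g.NT} {w : List T} :
    g.Yields [.nonterminal A] w ↔ ∃ r ∈ g.rules, r.input = A ∧ g.Yields r.output w := by
  constructor
  · intro h
    cases h with
    | nonterminal hr h₁ h₂ =>
      cases h₂
      exact ⟨_, hr, rfl, by simpa using h₁⟩
  · rintro ⟨r, hr, rfl, h⟩
    simpa using Yields.nonterminal hr h .nil

lemma Yields.derives {β : List (Symbol T g.NT)} {y : List T} (h : g.Yields β y) :
    g.Derives β (y.map .terminal) := by
  induction h with
  | nil => rfl
  | terminal a _ ih => exact ih.append_left [.terminal a]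
  | @nonterminal r hr β y z _ _ ih₁ ih₂ =>
    have h₀ : g.Derives [.nonterminal r.input] r.output :=
      Produces.single ⟨r, hr, .input_output⟩
    rw [List.map_append]
    exact ((h₀.trans ih₁).append_right β).trans (ih₂.append_left _)

lemma yields_map_terminal (y : List T) : g.Yields (y.map .terminal) y := by
  induction y with
  | nil => exact .nil
  | cons a y ih => exact ih.terminal a

lemma yields_iff_derives {β : List (Symbol T g.NT)} {y : List T} :
    g.Yields β y ↔ g.Derives β (y.map .terminal) := by
  refine ⟨Yields.derives, fun h ↦ ?_⟩
  induction h using Relation.ReflTransGen.head_induction_on with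
  | refl => exact yields_map_terminal y
  | head h _ ih =>
    obtain ⟨r, hr, hrw⟩ := h
    obtain ⟨p, q, rfl, rfl⟩ := hrw.exists_parts
    obtain ⟨y₁, z, rfl, h₁, hz⟩ := yields_append_iff.1 ih
    obtain ⟨x, y, rfl, hx, hy⟩ := yields_append_iff.1 h₁
    exact (hx.append (yields_nonterminal_iff.2 ⟨r, hr, rfl, hy⟩)).append hz

lemma mem_language_iff_yields {w : List T} :
    w ∈ g.language ↔ g.Yields [.nonterminal g.initial] w := by
  rw [mem_language_iff, yields_iff_derives]

/-- The language of a sentential form, given a language for each nonterminal. -/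
def formLanguage (g : ContextFreeGrammar T) (ℓ : g.NT → Language T) :
    List (Symbol T g.NT) → Language T
  | [] => {[]}
  | .terminal a :: β => {w | ∃ y ∈ formLanguage g ℓ β, w = a :: y}
  | .nonterminal A :: β => {w | ∃ y ∈ ℓ A, ∃ z ∈ formLanguage g ℓ β, w = y ++ z}

/-- Soundness: languages closed under the rules contain all the words that the grammar yields. -/
lemma Yields.mem_formLanguage (ℓ : g.NT → Language T)
    (hℓ : ∀ r ∈ g.rules, ∀ w ∈ g.formLanguage ℓ r.output, w ∈ ℓ r.input)
    {β : List (Symbol T g.NT)} {w : List T} (h : g.Yields β w) : w ∈ g.formLanguage ℓ β := by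
  induction h with
  | nil => exact rfl
  | terminal a _ ih => exact ⟨_, ih, rfl⟩
  | nonterminal hr _ _ ih₁ ih₂ => exact ⟨_, hℓ _ hr _ ih₁, _, ih₂, rfl⟩

/-! ### Interchangeable factors. -/

/-- The suffixes of the right-hand sides of the rules. -/
def ruleSuffixes (g : ContextFreeGrammar T) : Set (List (Symbol T g.NT)) :=
  {β | ∃ r ∈ g.rules, β <:+ r.output}

lemma finite_ruleSuffixes (g : ContextFreeGrammar T) : g.ruleSuffixes.Finite := by
  have : g.ruleSuffixes = ⋃ r ∈ g.rules, {β | β ∈ r.output.tails} := by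
    ext; simp [ruleSuffixes]
  rw [this]
  exact g.rules.finite_toSet.biUnion fun r _ ↦ List.finite_toSet _

/-- A long word has a factor of length between `K` and `2 * K` that is yielded by a suffix of a
rule, and that can be replaced by any other word which this suffix yields. -/
lemma Yields.exists_factor {K : ℕ} {β : List (Symbol T g.NT)} {w : List T} (h : g.Yields β w)
    (hβ : β ∈ g.ruleSuffixes) (hK : 1 ≤ K) (hw : K ≤ w.length) :
    ∃ γ ∈ g.ruleSuffixes, ∃ u y v, w = u ++ y ++ v ∧ K ≤ y.length ∧ y.length ≤ 2 * K ∧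
      g.Yields γ y ∧ ∀ y', g.Yields γ y' → g.Yields β (u ++ y' ++ v) := by
  induction h with
  | nil => simp at hw; omega
  | @terminal a β y h ih =>
    by_cases hl : (a :: y).length ≤ 2 * K
    · exact ⟨_, hβ, [], a :: y, [], by simp, hw, hl, h.terminal a, by simp⟩
    · obtain ⟨r, hr, hs⟩ := hβ
      obtain ⟨γ, hγ, u, z, v, rfl, h₁, h₂, h₃, h₄⟩ :=
        ih ⟨r, hr, (List.suffix_cons _ _).trans hs⟩ (by simp at hl; omega)
      exact ⟨γ, hγ, a :: u, z, v, rfl, h₁, h₂, h₃, fun y' hy' ↦ (h₄ y' hy').terminal a⟩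
  | @nonterminal r₀ hr₀ β y z hy hz ih₁ ih₂ =>
    by_cases hl : (y ++ z).length ≤ 2 * K
    · exact ⟨_, hβ, [], y ++ z, [], by simp, hw, hl, .nonterminal hr₀ hy hz, by simp⟩
    · rw [List.length_append] at hl
      -- The two parts together exceed `2 * K`, so one of them has length at least `K`. Working with
      -- rule suffixes makes every split binary without a normal form.
      by_cases hly : K ≤ y.length
      · obtain ⟨γ, hγ, u, x, v, rfl, h₁, h₂, h₃, h₄⟩ :=
          ih₁ ⟨r₀, hr₀, List.suffix_rfl⟩ hly
        refine ⟨γ, hγ, u, x, v ++ z, by simp, h₁, h₂, h₃, fun y' hy' ↦ ?_⟩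
        simpa using Yields.nonterminal hr₀ (h₄ y' hy') hz
      · obtain ⟨r, hr, hs⟩ := hβ
        obtain ⟨γ, hγ, u, x, v, rfl, h₁, h₂, h₃, h₄⟩ :=
          ih₂ ⟨r, hr, (List.suffix_cons _ _).trans hs⟩ (by omega)
        refine ⟨γ, hγ, y ++ u, x, v, by simp, h₁, h₂, h₃, fun y' hy' ↦ ?_⟩
        simpa using Yields.nonterminal hr₀ hy (h₄ y' hy')

end ContextFreeGrammar

/-- Interchange lemma: in a context-free language, every long word has a factor of length between
`K` and `2 * K` that belongs to one of finitely many classes and that can be replaced by any other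
word of the same class. -/
lemma Language.IsContextFree.exists_interchange {T : Type} {L : Language T}
    (hL : L.IsContextFree) :
    ∃ (F : Type) (_ : Finite F) (Y : F → Language T), ∀ K ≥ 1, ∀ w ∈ L, K ≤ w.length →
      ∃ f u y v, w = u ++ y ++ v ∧ K ≤ y.length ∧ y.length ≤ 2 * K ∧ y ∈ Y f ∧
        ∀ y' ∈ Y f, u ++ y' ++ v ∈ L := by
  obtain ⟨g, rfl⟩ := hL
  refine ⟨g.ruleSuffixes, g.finite_ruleSuffixes.to_subtype, fun β ↦ {y | g.Yields β.1 y}, ?_⟩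
  intro K hK w hw hlen
  obtain ⟨r, hr, hri, hrw⟩ :=
    ContextFreeGrammar.yields_nonterminal_iff.1 (ContextFreeGrammar.mem_language_iff_yields.1 hw)
  obtain ⟨γ, hγ, u, y, v, hw', h₁, h₂, h₃, h₄⟩ :=
    hrw.exists_factor ⟨r, hr, List.suffix_rfl⟩ hK hlen
  exact ⟨⟨γ, hγ⟩, u, y, v, hw', h₁, h₂, h₃, fun y' hy' ↦
    ContextFreeGrammar.mem_language_iff_yields.2
      (ContextFreeGrammar.yields_nonterminal_iff.2 ⟨r, hr, hri, h₄ y' hy'⟩)⟩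

/-! ### Counting letters by cell and offset. -/

lemma Finset.sum_range_mul_div_mod (f : ℕ → ℕ → ℕ) (m : ℕ) {B : ℕ} (hB : 0 < B) :
    ∑ t ∈ range (m * B), f (t / B) (t % B) = ∑ c ∈ range m, ∑ o ∈ range B, f c o := by
  induction m with
  | zero => simp
  | succ m ih =>
    rw [Nat.succ_mul, sum_range_add, ih, sum_range_succ]
    congr 1
    refine sum_congr rfl fun o ho ↦ ?_
    have ho := mem_range.1 ho
    rw [mul_comm, Nat.mul_add_div hB, Nat.mul_add_mod, Nat.div_eq_of_lt ho, Nat.mod_eq_of_lt ho,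
      add_zero]

lemma List.count_map_range' {α : Type*} [BEq α] [LawfulBEq α] [DecidableEq α] (f : ℕ → α) (a : α) (i j : ℕ) :
    ((range' i j).map f).count a = ((Finset.Ico i (i + j)).filter (f · = a)).card := by
  rw [Finset.card_filter]
  induction j with
  | zero => simp
  | succ j ih =>
    rw [range'_1_concat, map_append, count_append, ih, ← add_assoc,
      Finset.sum_Ico_succ_top (by omega)]
    simp [count_singleton]

lemma List.eq_map_range'_of_map_range_eq {α : Type*} {f : ℕ → α} {n : ℕ} {u y v : List α}
    (h : (range n).map f = u ++ y ++ v) : y = (range' u.length y.length).map f := by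
  have hn : n = u.length + y.length + v.length := by
    simpa [add_assoc] using congrArg length h
  subst hn
  rw [range_eq_range', ← range'_append_1, ← range'_append_1, map_append, map_append] at h
  have h₁ := (append_inj h (by simp)).1
  simpa using (append_inj h₁ (by simp)).2.symm

/-! ### Test words and their factors. -/

/-- The letter at position `t` of the test word with parameters `p`. The word consists of `60`
cells of length `2 * P`, where six consecutive cells form a region. In the first half of each cell,
the regions `k < 5` have `p k` occurrences of the letter `k`, and the regions `k + 5` have the
`P - p k` complementary ones. The second half of each cell of region `0` is filled with the sixth
letter. -/
def testLetter {P : ℕ} (p : Fin 5 → Fin P) (t : ℕ) : Option (Fin 6) :=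
  if t % (2 * P) < P then
    if t / (2 * P) < 30 ↔ t % (2 * P) < p (Fin.ofNat 5 (t / (2 * P) / 6)) then
      some (Fin.ofNat 5 (t / (2 * P) / 6)).castSucc
    else none
  else if t / (2 * P) < 6 then some (Fin.last 5) else none

section testLetter

variable {P : ℕ} {p q : Fin 5 → Fin P}

lemma testLetter_eq_castSucc_iff {t : ℕ} {k : Fin 5} :
    testLetter p t = some k.castSucc ↔ t % (2 * P) < P ∧ Fin.ofNat 5 (t / (2 * P) / 6) = k ∧
      (t / (2 * P) < 30 ↔ t % (2 * P) < p k) := by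
  have hk : Fin.last 5 ≠ k.castSucc := (Fin.castSucc_lt_last k).ne'
  unfold testLetter
  split_ifs with h₁ h₂ h₃
  · simp only [Option.some.injEq, Fin.castSucc_inj, h₁, true_and]
    exact ⟨fun h ↦ ⟨h, h ▸ h₂⟩, fun h ↦ h.1⟩
  · simp only [h₁, true_and, false_iff]
    rintro ⟨rfl, h⟩
    exact h₂ h
  · rw [Option.some.injEq]
    simp only [hk, h₁, false_and]
  · simp [h₁]

lemma testLetter_eq_last_iff {t : ℕ} :
    testLetter p t = some (Fin.last 5) ↔ P ≤ t % (2 * P) ∧ t / (2 * P) < 6 := by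
  unfold testLetter
  split_ifs with h₁ h₂ h₃
  · simp only [Option.some.injEq, (Fin.castSucc_lt_last _).ne, false_iff]
    omega
  · simp only [false_iff]
    omega
  · simp only [true_iff]
    omega
  · simp only [false_iff]
    omega

lemma card_filter_range_two_mul_lt {x : ℕ} (hx : x ≤ P) :
    ((Finset.range (2 * P)).filter fun o ↦ o < P ∧ o < x).card = x := by
  have : ((Finset.range (2 * P)).filter fun o ↦ o < P ∧ o < x) = Finset.range x := by
    ext o; simp; omega
  rw [this, Finset.card_range]

lemma card_filter_range_two_mul_ge {x : ℕ} :
    ((Finset.range (2 * P)).filter fun o ↦ o < P ∧ x ≤ o).card = P - x := by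
  have : ((Finset.range (2 * P)).filter fun o ↦ o < P ∧ x ≤ o) = Finset.Ico x P := by
    ext o; simp; omega
  rw [this, Nat.card_Ico]

/-- The parameters cancel between opposite regions: `6 * p k + 6 * (P - p k) = 6 * P`. The sixth
letter fills six half-cells of length `P`. -/
lemma count_testWord (p : Fin 5 → Fin P) (hP : 0 < P) (a : Fin 6) :
    ((List.range (60 * (2 * P))).map (testLetter p)).count (some a) = 6 * P := by
  rw [List.range_eq_range', List.count_map_range', Finset.card_filter, zero_add,
    ← Finset.range_eq_Ico]
  cases a using Fin.lastCases with
  | last =>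
    simp only [testLetter_eq_last_iff]
    rw [Finset.sum_range_mul_div_mod (fun c o ↦ if P ≤ o ∧ c < 6 then 1 else 0) 60
      (B := 2 * P) (by omega)]
    have h : ∀ c, ∑ o ∈ Finset.range (2 * P), (if P ≤ o ∧ c < 6 then 1 else 0) =
        if c < 6 then P else 0 := by
      intro c
      by_cases hc : c < 6
      · simp only [hc, and_true, if_true]
        rw [← Finset.card_filter]
        have : ((Finset.range (2 * P)).filter fun o ↦ P ≤ o) = Finset.Ico P (2 * P) := by
          ext o; simp; omega
        rw [this, Nat.card_Ico]
        omega
      · simp [hc]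
    simp only [h]
    rw [← Finset.sum_filter, Finset.sum_const]
    congr 1
  | cast k =>
    simp only [testLetter_eq_castSucc_iff]
    rw [Finset.sum_range_mul_div_mod
      (fun c o ↦ if o < P ∧ Fin.ofNat 5 (c / 6) = k ∧ (c < 30 ↔ o < p k) then 1 else 0) 60
      (B := 2 * P) (by omega)]
    have h : ∀ c, ∑ o ∈ Finset.range (2 * P),
        (if o < P ∧ Fin.ofNat 5 (c / 6) = k ∧ (c < 30 ↔ o < p k) then 1 else 0) =
        (if Fin.ofNat 5 (c / 6) = k ∧ c < 30 then (p k : ℕ) else 0) +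
          if Fin.ofNat 5 (c / 6) = k ∧ 30 ≤ c then P - p k else 0 := by
      intro c
      rw [← Finset.card_filter]
      generalize Fin.ofNat 5 (c / 6) = k'
      obtain rfl | hk := eq_or_ne k' k
      · by_cases hc : c < 30
        · simp [hc, not_le.2 hc, card_filter_range_two_mul_lt (p k').2.le]
        · simp [hc, not_lt.1 hc, card_filter_range_two_mul_ge]
      · simp [hk]
    simp only [h]
    rw [Finset.sum_add_distrib, ← Finset.sum_filter, ← Finset.sum_filter, Finset.sum_const,
      Finset.sum_const]
    have h₁ : ∀ k, ((Finset.range 60).filter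
        fun c ↦ Fin.ofNat 5 (c / 6) = k ∧ c < 30).card = 6 := by decide
    have h₂ : ∀ k, ((Finset.range 60).filter
        fun c ↦ Fin.ofNat 5 (c / 6) = k ∧ 30 ≤ c).card = 6 := by decide
    rw [h₁, h₂, smul_eq_mul, smul_eq_mul]
    have := (p k).2
    omega

/-- An interval of length between `15` and `30` cells contains whole cells of three consecutive
regions `r`, `r + 1`, `r + 2`, and does not meet the regions opposite to these. -/
lemma exists_region {B : ℕ} (hB : 0 < B) (i j : ℕ) (h₁ : 15 * B ≤ j) (h₂ : j ≤ 2 * (15 * B)) :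
    ∃ r, (∀ t ∈ Finset.Ico i (i + j), r ≤ t / B / 6 + 2 ∧ t / B / 6 ≤ r + 4) ∧
      ∀ e < 3, ∃ c, c / 6 = r + e ∧ ∀ o < B, c * B + o ∈ Finset.Ico i (i + j) := by
  set c₀ := i / B with hc₀
  set c₁ := (i + j - 1) / B with hc₁
  have hup : c₁ ≤ c₀ + 30 := by
    rw [hc₀, ← Nat.add_mul_div_right _ _ hB]
    exact Nat.div_le_div_right (by omega)
  have hlo : c₀ + 14 ≤ c₁ := by
    rw [hc₀, ← Nat.add_mul_div_right _ _ hB]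
    exact Nat.div_le_div_right (by omega)
  have ht : ∀ t ∈ Finset.Ico i (i + j), c₀ ≤ t / B ∧ t / B ≤ c₁ := by
    intro t ht
    rw [Finset.mem_Ico] at ht
    exact ⟨Nat.div_le_div_right ht.1, Nat.div_le_div_right (by omega)⟩
  have hfull : ∀ c, c₀ < c → c < c₁ → ∀ o < B, c * B + o ∈ Finset.Ico i (i + j) := by
    intro c h h' o ho
    rw [Finset.mem_Ico]
    have h₃ : i < B * (c₀ + 1) := Nat.lt_mul_div_succ i hB
    have h₄ : B * c₁ ≤ i + j - 1 := Nat.mul_div_le _ _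
    have h₅ := Nat.mul_le_mul_left B (Nat.succ_le_of_lt h)
    have h₆ := Nat.mul_le_mul_left B (Nat.succ_le_of_lt h')
    simp only [Nat.succ_eq_add_one, mul_add, mul_one] at h₃ h₅ h₆
    rw [mul_comm c B]
    omega
  -- Let `m = (c₀ + 1) / 6`. If the interval reaches region `m + 5`, opposite to `m`, the choice is
  -- `r = m + 1`; otherwise `r = m`.
  by_cases h : 6 * ((c₀ + 1) / 6 + 5) ≤ c₁
  · refine ⟨(c₀ + 1) / 6 + 1, fun t h' ↦ ?_, fun e he ↦ ?_⟩
    · have := ht t h'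
      omega
    · exact ⟨6 * ((c₀ + 1) / 6 + 1 + e), by omega, hfull _ (by omega) (by omega)⟩
  · refine ⟨(c₀ + 1) / 6, fun t h' ↦ ?_, fun e he ↦ ?_⟩
    · have := ht t h'
      omega
    -- Region `m` may begin before the interval, so cell `c₀ + 1` serves for `e = 0`. For `e = 2`
    -- the cell is at most `c₀ + 13 < c₁`, which is where 15 cells are needed.
    · exact ⟨max (c₀ + 1) (6 * ((c₀ + 1) / 6 + e)), by omega,
        hfull _ (by omega) (by omega)⟩

/-- If an interval contains a whole cell of the region `ρ` and no other occurrences of the letter of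
this region, then the number of occurrences of this letter determines its parameter. -/
lemma card_filter_testLetter_ne {I : Finset ℕ} {ρ c : ℕ}
    (hI : ∀ t ∈ I, Fin.ofNat 5 (t / (2 * P) / 6) = Fin.ofNat 5 ρ → t / (2 * P) / 6 = ρ)
    (hc : c / 6 = ρ) (hcI : ∀ o < 2 * P, c * (2 * P) + o ∈ I)
    (hpq : p (Fin.ofNat 5 ρ) ≠ q (Fin.ofNat 5 ρ)) :
    (I.filter (testLetter p · = some (Fin.ofNat 5 ρ).castSucc)).card ≠
      (I.filter (testLetter q · = some (Fin.ofNat 5 ρ).castSucc)).card := by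
  wlog hlt : p (Fin.ofNat 5 ρ) < q (Fin.ofNat 5 ρ) generalizing p q
  · exact (this hpq.symm (lt_of_le_of_ne (not_lt.1 hlt) hpq.symm)).symm
  have hlt' : (p (Fin.ofNat 5 ρ) : ℕ) < q (Fin.ofNat 5 ρ) := hlt
  have hq := (q (Fin.ofNat 5 ρ)).2
  generalize hk : Fin.ofNat 5 ρ = k at *
  have hpos : ∀ o < P, (c * (2 * P) + o) / (2 * P) = c ∧ (c * (2 * P) + o) % (2 * P) = o := by
    intro o ho
    rw [mul_comm c, Nat.mul_add_div (by omega), Nat.mul_add_mod, Nat.div_eq_of_lt (by omega),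
      Nat.mod_eq_of_lt (by omega), add_zero]
    exact ⟨rfl, rfl⟩
  obtain ⟨hdiv, hmod⟩ := hpos (p k) (by omega)
  have hmem := hcI (p k) (by omega)
  -- The sets of occurrences are nested, growing with the parameter if `ρ < 5` and shrinking
  -- otherwise. Offset `p k` of cell `c` makes the inclusion strict.
  by_cases hρ : ρ < 5
  · refine (Finset.card_lt_card (Finset.ssubset_iff_of_subset ?_ |>.2
      ⟨c * (2 * P) + p k, ?_, ?_⟩)).ne
    · intro t ht
      rw [Finset.mem_filter, testLetter_eq_castSucc_iff] at ht ⊢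
      have := hI t ht.1 ht.2.2.1
      refine ⟨ht.1, ht.2.1, ht.2.2.1, ?_⟩
      have := ht.2.2.2
      omega
    · rw [Finset.mem_filter, testLetter_eq_castSucc_iff, hdiv, hmod, hc]
      exact ⟨hmem, by omega, hk, by omega⟩
    · rw [Finset.mem_filter, testLetter_eq_castSucc_iff, hdiv, hmod]
      omega
  · refine (Finset.card_lt_card (Finset.ssubset_iff_of_subset ?_ |>.2
      ⟨c * (2 * P) + p k, ?_, ?_⟩)).ne'
    · intro t ht
      rw [Finset.mem_filter, testLetter_eq_castSucc_iff] at ht ⊢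
      have := hI t ht.1 ht.2.2.1
      refine ⟨ht.1, ht.2.1, ht.2.2.1, ?_⟩
      have := ht.2.2.2
      omega
    · rw [Finset.mem_filter, testLetter_eq_castSucc_iff, hdiv, hmod, hc]
      exact ⟨hmem, by omega, hk, by omega⟩
    · rw [Finset.mem_filter, testLetter_eq_castSucc_iff, hdiv, hmod]
      omega

end testLetter

/-! ### Pigeonhole and the swap. -/

lemma exists_fin_five_ofNat_eq (r : ℕ) (k : Fin 5) : ∃ e < 5, k = Fin.ofNat 5 (r + e) := by
  refine ⟨(k + 5 - r % 5) % 5, by omega, ?_⟩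
  ext
  simp only [Fin.ofNat]
  have := k.2
  omega

lemma not_isContextFree_of_forall_count_eq_iff_zip_mem {Γ : Type} {h : ℕ → List Γ}
    (hlen : ∀ n, (h n).length = n) {L : Language (Option (Fin 6) × Γ)}
    (hL : ∀ x : List (Option (Fin 6)),
      (∀ a b : Fin 6, x.count (some a) = x.count (some b)) ↔ x.zip (h x.length) ∈ L) :
    ¬ L.IsContextFree := by
  intro hCF
  obtain ⟨F, _, Y, hY⟩ := Language.IsContextFree.exists_interchange hCF
  have := Fintype.ofFinite F
  -- Each of the two lengths giving a factor's position has `n + 1 = 120 * P + 1 ≤ 121 * P` possible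
  -- values.
  obtain ⟨P, hP⟩ : ∃ P, P = 121 ^ 2 * Fintype.card F + 1 := ⟨_, rfl⟩
  have hP0 : 0 < P := by omega
  set n := 60 * (2 * P) with hn
  set w : (Fin 5 → Fin P) → List (Option (Fin 6)) := fun p ↦ (List.range n).map (testLetter p)
    with hw
  have hwlen : ∀ p, (w p).length = n := fun p ↦ by simp [hw]
  have hwmem : ∀ p (a b : Fin 6), (w p).count (some a) = (w p).count (some b) := fun p a b ↦
    (count_testWord p hP0 a).trans (count_testWord p hP0 b).symm
  have hz : ∀ p, (w p).zip (h n) ∈ L := fun p ↦ by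
    have := (hL (w p)).1 (hwmem p)
    rwa [hwlen] at this
  have hzfst : ∀ p, ((w p).zip (h n)).map Prod.fst = w p := fun p ↦
    List.map_fst_zip (by rw [hwlen, hlen])
  have hzsnd : ∀ p, ((w p).zip (h n)).map Prod.snd = h n := fun p ↦
    List.map_snd_zip (by rw [hwlen, hlen])
  choose f u y v hdec hylo hyhi hyY hswap using fun p ↦
    hY (15 * (2 * P)) (by omega) _ (hz p) (by rw [List.length_zip, hwlen, hlen]; omega)
  have hdlen : ∀ p, (u p).length + (y p).length + (v p).length = n := fun p ↦ by
    have := congrArg List.length (hdec p)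
    rw [List.length_zip, hwlen, hlen] at this
    simp at this
    omega
  -- `r` is a function of the two lengths alone, so colliding words share it.
  choose! r hr using exists_region (B := 2 * P) (by omega)
  obtain ⟨p, q, hpq, heq⟩ : ∃ p q, p ≠ q ∧ (fun p : Fin 5 → Fin P ↦ ((f p,
      (⟨(u p).length, by have := hdlen p; omega⟩ : Fin (n + 1)),
      (⟨(y p).length, by have := hdlen p; omega⟩ : Fin (n + 1)),
      p (Fin.ofNat 5 (r (u p).length (y p).length + 3)),
      p (Fin.ofNat 5 (r (u p).length (y p).length + 4))) :
      F × Fin (n + 1) × Fin (n + 1) × Fin P × Fin P)) p = (fun p : Fin 5 → Fin P ↦ ((f p,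
      (⟨(u p).length, by have := hdlen p; omega⟩ : Fin (n + 1)),
      (⟨(y p).length, by have := hdlen p; omega⟩ : Fin (n + 1)),
      p (Fin.ofNat 5 (r (u p).length (y p).length + 3)),
      p (Fin.ofNat 5 (r (u p).length (y p).length + 4))) :
      F × Fin (n + 1) × Fin (n + 1) × Fin P × Fin P)) q := by
    refine Fintype.exists_ne_map_eq_of_card_lt _ ?_
    simp only [Fintype.card_prod, Fintype.card_fin, Fintype.card_fun]
    calc Fintype.card F * ((n + 1) * ((n + 1) * (P * P)))
        ≤ Fintype.card F * ((121 * P) * ((121 * P) * (P * P))) := by gcongr <;> omega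
      _ = (121 ^ 2 * Fintype.card F) * P ^ 4 := by ring
      _ < P * P ^ 4 := by gcongr; omega
      _ = P ^ 5 := by ring
  simp only [Prod.mk.injEq, Fin.mk.injEq] at heq
  obtain ⟨hf, hu, hy, h3, h4⟩ := heq
  rw [← hu, ← hy] at h3 h4
  obtain ⟨hr₁, hr₂⟩ := hr (u p).length (y p).length (hylo p) (hyhi p)
  generalize r (u p).length (y p).length = ρ at *
  obtain ⟨e, he, hpqe⟩ : ∃ e < 3, p (Fin.ofNat 5 (ρ + e)) ≠ q (Fin.ofNat 5 (ρ + e)) := by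
    by_contra! hcon
    refine hpq (funext fun k ↦ ?_)
    obtain ⟨e, he, rfl⟩ := exists_fin_five_ofNat_eq ρ k
    obtain he | rfl | rfl : e < 3 ∨ e = 3 ∨ e = 4 := by omega
    exacts [hcon e he, h3, h4]
  obtain ⟨c, hc, hcI⟩ := hr₂ e he
  have hne := card_filter_testLetter_ne (ρ := ρ + e) (fun t ht hk ↦ by
    have := hr₁ t ht
    have hk := congrArg Fin.val hk
    simp only [Fin.ofNat] at hk
    omega) hc hcI hpqe
  have hfst : ∀ p, w p = (u p).map Prod.fst ++ (y p).map Prod.fst ++ (v p).map Prod.fst :=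
    fun p ↦ by rw [← List.map_append, ← List.map_append, ← hdec, hzfst]
  have hyw : ∀ p, (y p).map Prod.fst =
      (List.range' (u p).length (y p).length).map (testLetter p) := fun p ↦ by
    have := List.eq_map_range'_of_map_range_eq (hfst p)
    rwa [List.length_map, List.length_map] at this
  have hsnd : ∀ p, h n = (u p).map Prod.snd ++ (y p).map Prod.snd ++ (v p).map Prod.snd :=
    fun p ↦ by rw [← List.map_append, ← List.map_append, ← hdec, hzsnd]
  -- Both factors cover the same positions of the same advice string.
  have hysnd : (y p).map Prod.snd = (y q).map Prod.snd := by
    have h₁ := (List.append_inj ((hsnd p).symm.trans (hsnd q)) (by simp [hu, hy])).1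
    exact (List.append_inj h₁ (by simp [hu])).2
  have hs := hswap p (y q) (hf ▸ hyY q)
  set s := u p ++ y q ++ v p with hs_def
  have hsmem : ∀ a b : Fin 6,
      (s.map Prod.fst).count (some a) = (s.map Prod.fst).count (some b) := by
    refine (hL _).2 ?_
    have hslen : (s.map Prod.fst).length = n := by
      have := hdlen p
      simp [hs_def]
      omega
    have hssnd : s.map Prod.snd = h n := by
      rw [hsnd p, hs_def, List.map_append, List.map_append, hysnd]
    rw [hslen, ← hssnd, ← List.zip_of_prod (xs := s) rfl rfl]
    exact hs
  have hcount : ∀ a b : Fin 6, ((y p).map Prod.fst).count (some a) +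
      ((y q).map Prod.fst).count (some b) = ((y p).map Prod.fst).count (some b) +
      ((y q).map Prod.fst).count (some a) := by
    intro a b
    have h₁ := hwmem p a b
    have h₂ := hsmem a b
    rw [hfst p] at h₁
    simp only [hs_def, List.map_append, List.count_append] at h₁ h₂
    omega
  -- The counts of the sixth letter agree in both factors, so those of the other letter would have
  -- to agree too, against `hne`.
  have hfin := hcount (Fin.ofNat 5 (ρ + e)).castSucc (Fin.last 5)
  rw [hyw p, hyw q, ← hu, ← hy] at hfin
  simp only [List.count_map_range', testLetter_eq_last_iff] at hfin
  omega

theorem Equal6_notMem_advised_CFL : Equal6 ∉ LanguageFamily.advised LanguageFamily.CFL :=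
  fun ⟨_, _, _, _, _, hlen, hCF, hL⟩ ↦
    not_isContextFree_of_forall_count_eq_iff_zip_mem hlen hL hCF

/-! ### A context-free grammar for the complement. -/

/-- A sequence of weights at most `1` with a sum above `c ≥ 0` has a step of weight `1` at
height `c`. -/
lemma List.exists_eq_append_cons_of_lt_sum_map {α : Type*} {δ : α → ℤ} (hδ : ∀ a, δ a ≤ 1)
    {w : List α} {c : ℤ} (hc : 0 ≤ c) (hw : c < (w.map δ).sum) :
    ∃ u a v, w = u ++ a :: v ∧ (u.map δ).sum = c ∧ δ a = 1 := by
  induction w generalizing c with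
  | nil => simp at hw; omega
  | cons a w ih =>
    rw [map_cons, sum_cons] at hw
    have ha := hδ a
    by_cases h : c = 0 ∧ δ a = 1
    · exact ⟨[], a, w, rfl, h.1.symm, h.2⟩
    · obtain ⟨u, b, v, rfl, hu, hb⟩ := ih (c := c - δ a) (by omega) (by omega)
      exact ⟨a :: u, b, v, rfl, by rw [map_cons, sum_cons, hu]; omega, hb⟩

/-- The grammar of the words that have a positive weight for some index `d`. -/
noncomputable def posWeightGrammar {α : Type*} {ι : Type} [Finite α] [Finite ι] (δ : ι → α → ℤ) :
    ContextFreeGrammar α where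
  NT := Option ι
  initial := none
  rules := Set.Finite.toFinset (s :=
    (Set.range fun x : {x : ι × α // 0 < δ x.1 x.2} ↦ (⟨none,
      [.nonterminal (some x.1.1), .terminal x.1.2, .nonterminal (some x.1.1)]⟩ :
        ContextFreeRule α (Option ι))) ∪
    (Set.range fun d : ι ↦ (⟨some d, []⟩ : ContextFreeRule α (Option ι))) ∪
    (Set.range fun x : {x : ι × α // 0 ≤ δ x.1 x.2} ↦ (⟨some x.1.1,
      [.terminal x.1.2, .nonterminal (some x.1.1)]⟩ : ContextFreeRule α (Option ι))) ∪
    (Set.range fun x : {x : ι × α × α // 0 ≤ δ x.1 x.2.1 + δ x.1 x.2.2} ↦ (⟨some x.1.1,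
      [.terminal x.1.2.1, .nonterminal (some x.1.1), .terminal x.1.2.2,
        .nonterminal (some x.1.1)]⟩ : ContextFreeRule α (Option ι)))) (Set.toFinite _)

section posWeightGrammar

variable {α : Type*} {ι : Type} [Finite α] [Finite ι] {δ : ι → α → ℤ}

lemma mem_rules_posWeightGrammar {r : ContextFreeRule α (Option ι)} :
    r ∈ (posWeightGrammar δ).rules ↔
      (∃ d a, 0 < δ d a ∧
        r = ⟨none, [.nonterminal (some d), .terminal a, .nonterminal (some d)]⟩) ∨
      (∃ d, r = ⟨some d, []⟩) ∨
      (∃ d a, 0 ≤ δ d a ∧ r = ⟨some d, [.terminal a, .nonterminal (some d)]⟩) ∨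
      ∃ d a b, 0 ≤ δ d a + δ d b ∧ r = ⟨some d,
        [.terminal a, .nonterminal (some d), .terminal b, .nonterminal (some d)]⟩ := by
  refine (Set.Finite.mem_toFinset _).trans ?_
  simp only [Set.mem_union, Set.mem_range, or_assoc, Subtype.exists, Prod.exists, exists_prop,
    eq_comm]

lemma yields_posWeightGrammar_of_nonneg (hδ : ∀ d a, |δ d a| ≤ 1) (d : ι) (w : List α)
    (hw : 0 ≤ (w.map (δ d)).sum) :
    (posWeightGrammar δ).Yields [.nonterminal (some d)] w := by
  obtain ⟨n, hn⟩ : ∃ n, n = w.length := ⟨_, rfl⟩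
  induction n using Nat.strong_induction_on generalizing w with
  | _ n ih =>
    refine ContextFreeGrammar.yields_nonterminal_iff.2 ?_
    have hstep : ∀ a u b v, w = a :: (u ++ b :: v) → 0 ≤ (u.map (δ d)).sum →
        0 ≤ (v.map (δ d)).sum → 0 ≤ δ d a + δ d b → ∃ r ∈ (posWeightGrammar δ).rules,
          r.input = some d ∧ (posWeightGrammar δ).Yields r.output w := by
      rintro a u b v rfl hu hv hab
      simp only [List.length_cons, List.length_append] at hn
      refine ⟨_, mem_rules_posWeightGrammar.2 (.inr (.inr (.inr ⟨d, a, b, hab, rfl⟩))), rfl, ?_⟩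
      exact .terminal a ((ih _ (by omega) u hu rfl).append
        ((ih _ (by omega) v hv rfl).terminal b))
    cases w with
    | nil => exact ⟨_, mem_rules_posWeightGrammar.2 (.inr (.inl ⟨d, rfl⟩)), rfl, .nil⟩
    | cons a w =>
      have ha := abs_le.1 (hδ d a)
      rw [List.map_cons, List.sum_cons] at hw
      by_cases h : 0 ≤ δ d a ∧ 0 ≤ (w.map (δ d)).sum
      · refine ⟨_, mem_rules_posWeightGrammar.2 (.inr (.inr (.inl ⟨d, a, h.1, rfl⟩))), rfl, ?_⟩
        exact .terminal a (ih _ (by simp [hn]) w h.2 rfl)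
      -- Now `δ d a` is `-1` with a positive rest, or `1` with a rest of sum `-1`. The letter is
      -- matched with the first one of opposite weight at height `0`; the word between sums to `0`
      -- and the remainder stays nonnegative.
      · by_cases hs : 0 < (w.map (δ d)).sum
        · obtain ⟨u, b, v, rfl, hu, hb⟩ := List.exists_eq_append_cons_of_lt_sum_map
            (fun a ↦ (abs_le.1 (hδ d a)).2) le_rfl hs
          rw [List.map_append, List.sum_append, List.map_cons, List.sum_cons] at hw h hs
          exact hstep a u b v rfl hu.ge (by omega) (by omega)
        · have hneg : ∀ w : List α, (w.map fun a ↦ -δ d a).sum = -(w.map (δ d)).sum :=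
            fun w ↦ by rw [List.sum_neg, List.map_map]; rfl
          obtain ⟨u, b, v, rfl, hu, hb⟩ := List.exists_eq_append_cons_of_lt_sum_map (w := w)
            (δ := fun a ↦ -δ d a) (fun a ↦ by have := (abs_le.1 (hδ d a)).1; omega) le_rfl
            (by rw [hneg]; omega)
          rw [hneg] at hu
          rw [List.map_append, List.sum_append, List.map_cons, List.sum_cons] at hw h hs
          exact hstep a u b v rfl (by omega) (by omega) (by omega)

theorem isContextFree_exists_sum_pos (hδ : ∀ d a, |δ d a| ≤ 1) :
    Language.IsContextFree {w : List α | ∃ d, 0 < (w.map (δ d)).sum} := by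
  refine ⟨posWeightGrammar δ, Set.ext fun w ↦ ?_⟩
  refine ContextFreeGrammar.mem_language_iff_yields.trans ⟨fun h ↦ ?_, fun ⟨d, hd⟩ ↦ ?_⟩
  · let ℓ : Option ι → Language α := fun A ↦
      A.elim {w | ∃ d, 0 < (w.map (δ d)).sum} fun d ↦ {w | 0 ≤ (w.map (δ d)).sum}
    obtain ⟨y, hy, z, rfl, rfl⟩ := h.mem_formLanguage ℓ <| by
      intro r hr w hw
      obtain ⟨d, a, ha, rfl⟩ | ⟨d, rfl⟩ | ⟨d, a, ha, rfl⟩ | ⟨d, a, b, hab, rfl⟩ :=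
        mem_rules_posWeightGrammar.1 hr
      · obtain ⟨u, hu, _, ⟨_, ⟨v, hv, _, rfl, rfl⟩, rfl⟩, rfl⟩ := hw
        have hu : 0 ≤ (u.map (δ d)).sum := hu
        have hv : 0 ≤ (v.map (δ d)).sum := hv
        refine ⟨d, ?_⟩
        simp
        omega
      · obtain rfl := hw
        exact le_refl (0 : ℤ)
      · obtain ⟨_, ⟨v, hv, _, rfl, rfl⟩, rfl⟩ := hw
        have hv : 0 ≤ (v.map (δ d)).sum := hv
        change 0 ≤ (List.map (δ d) _).sum
        simp
        omega
      · obtain ⟨_, ⟨u, hu, _, ⟨_, ⟨v, hv, _, rfl, rfl⟩, rfl⟩, rfl⟩, rfl⟩ := hw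
        have hu : 0 ≤ (u.map (δ d)).sum := hu
        have hv : 0 ≤ (v.map (δ d)).sum := hv
        change 0 ≤ (List.map (δ d) _).sum
        simp
        omega
    rw [List.append_nil]
    exact hy
  · obtain ⟨u, a, v, rfl, hu, ha⟩ := List.exists_eq_append_cons_of_lt_sum_map
      (fun a ↦ (abs_le.1 (hδ d a)).2) le_rfl hd
    rw [List.map_append, List.sum_append, List.map_cons, List.sum_cons] at hd
    refine ContextFreeGrammar.yields_nonterminal_iff.2
      ⟨_, mem_rules_posWeightGrammar.2 (.inl ⟨d, a, by omega, rfl⟩), rfl, ?_⟩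
    exact (yields_posWeightGrammar_of_nonneg hδ d u hu.ge).append
      ((yields_posWeightGrammar_of_nonneg hδ d v (by omega)).terminal a)

end posWeightGrammar

/-- The words over any finite alphabet whose image under `π` is not in `Equal₆` form a context-free
language. -/
theorem isContextFree_map_notMem_Equal6 {α : Type*} [Finite α] (π : α → Option (Fin 6)) :
    Language.IsContextFree {w : List α | w.map π ∉ Equal6.strings} := by
  let δ : Fin 6 × Fin 6 → α → ℤ := fun d a ↦
    (if π a = some d.1 then 1 else 0) - if π a = some d.2 then 1 else 0
  have hδ : ∀ d a, |δ d a| ≤ 1 := fun d a ↦ by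
    simp only [δ]
    split_ifs <;> simp
  have hsum : ∀ d (w : List α), (w.map (δ d)).sum =
      ((w.map π).count (some d.1) : ℤ) - (w.map π).count (some d.2) := by
    intro d w
    induction w with
    | nil => simp
    | cons a w ih =>
      simp only [List.map_cons, List.sum_cons, List.count_cons, ih, δ, beq_iff_eq]
      push_cast
      ring
  refine (congrArg Language.IsContextFree (Set.ext fun w ↦ ?_)).mpr
    (isContextFree_exists_sum_pos hδ)
  change (¬ ∀ i j : Fin 6, (w.map π).count (some i) = (w.map π).count (some j)) ↔
    ∃ d, 0 < (w.map (δ d)).sum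
  simp only [hsum, not_forall]
  constructor
  · rintro ⟨i, j, hij⟩
    obtain h | h := Nat.lt_or_gt_of_ne hij
    · exact ⟨(j, i), by simp only; omega⟩
    · exact ⟨(i, j), by simp only; omega⟩
  · rintro ⟨d, hd⟩
    exact ⟨d.1, d.2, by omega⟩

theorem Equal6_mem_co_CFL : Equal6 ∈ LanguageFamily.co LanguageFamily.CFL := by
  have h := isContextFree_map_notMem_Equal6 (id : Option (Fin 6) → Option (Fin 6))
  simp only [List.map_id] at h
  exact h

/-! ### Trivial advice over a one-letter alphabet, and the conclusions. -/

lemma List.map_fst_zip_replicate_unit {α : Type*} (x : List α) :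
    (x.zip (replicate x.length ())).map Prod.fst = x :=
  map_fst_zip (by simp)

theorem Equal6_mem_advised_co_CFL :
    Equal6 ∈ LanguageFamily.advised (LanguageFamily.co LanguageFamily.CFL) := by
  refine ⟨Unit, inferInstance, inferInstance, fun n ↦ List.replicate n (),
    {w | w.map Prod.fst ∈ Equal6.strings}, by simp, ?_, fun x ↦ ?_⟩
  · exact isContextFree_map_notMem_Equal6 (Prod.fst : Option (Fin 6) × Unit → _)
  · change _ ↔ (x.zip (List.replicate x.length ())).map Prod.fst ∈ Equal6.strings
    rw [List.map_fst_zip_replicate_unit]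

theorem complement_Equal6_mem_advised_CFL :
    Equal6.complement ∈ LanguageFamily.advised LanguageFamily.CFL := by
  refine ⟨Unit, inferInstance, inferInstance, fun n ↦ List.replicate n (),
    {w | w.map Prod.fst ∉ Equal6.strings}, by simp, ?_, fun x ↦ ?_⟩
  · exact isContextFree_map_notMem_Equal6 (Prod.fst : Option (Fin 6) × Unit → _)
  · change _ ↔ (x.zip (List.replicate x.length ())).map Prod.fst ∉ Equal6.strings
    rw [List.map_fst_zip_replicate_unit]
    rfl

lemma FormalLanguage.complement_complement (L : FormalLanguage) :
    L.complement.complement = L := by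
  obtain ⟨A, S⟩ := L
  exact congrArg (FormalLanguage.mk A) (Set.ext fun w ↦ not_not)

theorem proposition4p4 :
    -- `Equal₆` separates `co-CFL` from `CFL/n`
    Equal6 ∈ LanguageFamily.co LanguageFamily.CFL ∧
    Equal6 ∉ LanguageFamily.advised LanguageFamily.CFL ∧
    -- `co-CFL ⊄ CFL/n`
    ¬ LanguageFamily.co LanguageFamily.CFL ⊆ LanguageFamily.advised LanguageFamily.CFL ∧
    -- `co-CFL/n ≠ CFL/n`, for both ways of bracketing `co-CFL/n`
    LanguageFamily.advised (LanguageFamily.co LanguageFamily.CFL) ≠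
      LanguageFamily.advised LanguageFamily.CFL ∧
    LanguageFamily.co (LanguageFamily.advised LanguageFamily.CFL) ≠
      LanguageFamily.advised LanguageFamily.CFL ∧
    -- `CFL/n` is not closed under complementation
    ¬ LanguageFamily.ClosedUnderComplement (LanguageFamily.advised LanguageFamily.CFL) := by
  have hco := Equal6_mem_co_CFL
  have hn := Equal6_notMem_advised_CFL
  have hc := complement_Equal6_mem_advised_CFL
  refine ⟨hco, hn, fun h ↦ hn (h hco), fun h ↦ hn (h ▸ Equal6_mem_advised_co_CFL),
    fun h ↦ hn (h ▸ (show Equal6 ∈ LanguageFamily.co _ from hc)), fun h ↦ hn ?_⟩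
  rw [← Equal6.complement_complement]
  exact h _ hc
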